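/- For a cardinal $\kappa$ (identified with its initial ordinal) let ${}^{\kappa}\kappa$ be the set of all functions from $\kappa$ to $\kappa$, and write $(\forall^\kappa i<\kappa)$ for "for all but fewer than $\kappa$ many $i<\kappa$". For a cardinal $\theta\le\kappa$ let $\mathcal S^\theta_\kappa=\prod_{i<\kappa}[\kappa]^{<\theta}$ be the set of all sequences $\bar S=\langle S_i:i<\kappa\rangle$ of subsets of $\kappa$ with $|S_i|<\theta$ for every $i<\kappa$. Put $$\mathfrak e_\kappa=\min\{|F|: F\subseteq{}^{\kappa}\kappa\ \text{ and }\ (\forall g\in{}^{\kappa}\kappa)(\exists f\in F)(\forall^\kappa i<\kappa)\ f(i)\ne g(i)\},$$ $$\mathrm b(\kappa,\theta)=\min\{|F|: F\subseteq{}^{\kappa}\kappa\ \text{ and }\ (\forall \bar S\in\mathcal S^\theta_\kappa)(\exists f\in F)(\forall^\kappa i<\kappa)\ f(i)\notin S_i\}.$$ Proposition. If $\kappa$ is a singular cardinal and $2\le\theta<\kappa$, then $\mathfrak e_\kappa=\mathrm b(\kappa,\theta)=\kappa^+$. -/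

import Mathlib

open Cardinal

universe u

namespace CardInv

/-- The index set `κ`, i.e. the initial ordinal of the cardinal `κ`, as a well-ordered type. -/
abbrev Idx (κ : Cardinal.{u}) : Type u := κ.ord.ToType

/-- `(∀^κ i < κ) P i`: the property `P` holds for all but less than `κ` many `i < κ`. -/
def ForallMost (κ : Cardinal.{u}) (P : Idx κ → Prop) : Prop :=
  #{i : Idx κ | ¬ P i} < κ

/-- The set of all sequences `⟨S i : i < κ⟩` of subsets of `κ` with `|S i| < θ` for every `i`. -/
def slaloms (κ θ : Cardinal.{u}) : Set (Idx κ → Set (Idx κ)) :=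
  {S | ∀ i, #(S i) < θ}

/-- `F ⊆ ^κ κ` is such that every `g : κ → κ` is eventually different (off a set of size `< κ`)
from some `f ∈ F`. -/
def IsEventuallyDifferent (κ : Cardinal.{u}) (F : Set (Idx κ → Idx κ)) : Prop :=
  ∀ g : Idx κ → Idx κ, ∃ f ∈ F, ForallMost κ (fun i => f i ≠ g i)

/-- `F ⊆ ^κ κ` is such that every `S ∈ slaloms κ θ` is eventually avoided by some `f ∈ F`. -/
def IsEventuallyAvoiding (κ θ : Cardinal.{u}) (F : Set (Idx κ → Idx κ)) : Prop :=
  ∀ S ∈ slaloms κ θ, ∃ f ∈ F, ForallMost κ (fun i => f i ∉ S i)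

/-- The cardinal `𝔢_κ`, the least cardinality of an `F` with `IsEventuallyDifferent κ F`. -/
noncomputable def eNum (κ : Cardinal.{u}) : Cardinal.{u} :=
  sInf {c | ∃ F : Set (Idx κ → Idx κ), IsEventuallyDifferent κ F ∧ c = #F}

/-- The cardinal `b(κ, θ)`, the least cardinality of an `F` with `IsEventuallyAvoiding κ θ F`. -/
noncomputable def bNum (κ θ : Cardinal.{u}) : Cardinal.{u} :=
  sInf {c | ∃ F : Set (Idx κ → Idx κ), IsEventuallyAvoiding κ θ F ∧ c = #F}

end CardInv

/-! ### Cofinality, clubs and club guessing in well-orders -/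

section WellOrders

open Order Set

/-! A function is a slalom of singletons, so an avoiding family is eventually different. It
therefore suffices that no eventually different family has size at most `κ`
(`succ_le_mk_of_isEventuallyDifferent`, a diagonal argument) and that some avoiding family has size
at most `κ⁺` (`exists_isEventuallyAvoiding`).

The second part is pcf theory. Take a cofinal `A ⊆ κ` with `#A = cof κ`, and functions `f α : A →
κ`, `α < κ⁺`, increasing modulo tails, with an exact upper bound `g` such that `cof (g n)` tends to
`κ`. Cut `κ` into blocks indexed by `A`, block `n` being smaller than `cof (g n)`, and copy `f α n`
over the whole block. The values of a slalom on block `n` that lie below `g n` are bounded by some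
`h n < g n`. Exactness gives `α` with `h < f α < g` on a tail, so `f α` avoids the slalom there.

The exact upper bound comes from a sequence in which each `f δ` uniformly dominates the earlier
functions along a small club of `δ` (`exists_scale`). With club guessing (`exists_clubGuessing`)
this makes the projections of the sequence to small sets stabilise (`exists_leastGE_stable`), which
yields both exactness (`exists_exactUpperBound`) and large cofinalities
(`eventually_lt_cof_Iio_of_exactUpperBound`). -/

theorem exists_isLUB_of_bddAbove {α : Type u} [LinearOrder α] [WellFoundedLT α] {s : Set α}
    (hs : BddAbove s) : ∃ x, IsLUB s x :=
  ⟨wellFounded_lt.min (upperBounds s) hs, wellFounded_lt.min_mem _ hs,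
    fun _ hb => wellFounded_lt.min_le hb⟩

theorem exists_forall_lt_of_mk_lt_cof {α : Type u} [LinearOrder α] {s : Set α}
    (hs : #s < Order.cof α) : ∃ x, ∀ y ∈ s, y < x :=
  not_isCofinal_iff.1 fun h => (cof_le h).not_gt hs

theorem exists_forall_lt_of_mk_index_lt_cof {α ι : Type u} [LinearOrder α] (f : ι → α)
    (hι : #ι < Order.cof α) : ∃ x, ∀ i, f i < x := by
  obtain ⟨x, hx⟩ := exists_forall_lt_of_mk_lt_cof (mk_range_le.trans_lt hι : #(range f) < _)
  exact ⟨x, fun i => hx _ ⟨i, rfl⟩⟩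

theorem noMaxOrder_of_aleph0_le_cof {α : Type u} [LinearOrder α] (h : ℵ₀ ≤ Order.cof α) :
    NoMaxOrder α := by
  refine ⟨fun a => ?_⟩
  obtain ⟨x, hx⟩ := exists_forall_lt_of_mk_lt_cof (s := {a})
    (by simpa using Cardinal.one_lt_aleph0.trans_le h)
  exact ⟨x, hx a rfl⟩

theorem nonempty_of_aleph0_le_cof {α : Type u} [LinearOrder α] (h : ℵ₀ ≤ Order.cof α) :
    Nonempty α := by
  rw [← cof_ne_zero_iff]
  exact (aleph0_pos.trans_le h).ne'

theorem mk_Iio_ord_lt {c : Cardinal.{u}} (i : c.ord.ToType) : #(Iio i) < c := by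
  simpa using mk_Iio_lt i (by simp)

theorem Cardinal.IsRegular.cof_toType {c : Cardinal.{u}} (hc : c.IsRegular) :
    Order.cof c.ord.ToType = c := by
  rw [Ordinal.cof_toType, hc.cof_ord]

theorem IsCofinal.exists_lt_mem {α : Type u} [LinearOrder α] [NoMaxOrder α] {s : Set α}
    (hs : IsCofinal s) (x : α) : ∃ y ∈ s, x < y := by
  obtain ⟨z, hz⟩ := exists_gt x
  obtain ⟨y, hy, hzy⟩ := hs z
  exact ⟨y, hy, hz.trans_le hzy⟩

/-- A cofinal set contains increasing sequences of every length whose proper initial segments are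
smaller than the cofinality. -/
theorem exists_strictMono_mem_of_isCofinal {α β : Type u} [LinearOrder α] [NoMaxOrder α]
    [LinearOrder β] [WellFoundedLT β] {s : Set α} (hs : IsCofinal s)
    (hβ : ∀ i : β, #(Iio i) < Order.cof α) : ∃ e : β → α, StrictMono e ∧ ∀ i, e i ∈ s := by
  have key : ∀ (i : β) (f : ∀ j, j < i → α), ∃ y ∈ s, ∀ j h, f j h < y := by
    intro i f
    obtain ⟨x, hx⟩ := exists_forall_lt_of_mk_index_lt_cof (fun j : Iio i => f j.1 j.2) (hβ i)
    obtain ⟨y, hy, hxy⟩ := IsCofinal.exists_lt_mem hs x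
    exact ⟨y, hy, fun j h => (hx ⟨j, h⟩).trans hxy⟩
  choose g hgs hg using key
  let e : β → α := WellFoundedLT.fix g
  have he : ∀ i, e i = g i fun j _ => e j := fun i => WellFoundedLT.fix_eq g i
  refine ⟨e, fun j i hji => ?_, fun i => ?_⟩
  · rw [he i]
    exact hg i (fun j _ => e j) j hji
  · rw [he i]
    exact hgs _ _

/-- A well-order without maximum has a club whose cardinality is its cofinality. -/
theorem exists_isClub_mk_le_cof (α : Type u) [LinearOrder α] [WellFoundedLT α] [NoMaxOrder α] :
    ∃ s : Set α, IsClub s ∧ #s ≤ Order.cof α := by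
  obtain ⟨X, hX, hXc⟩ := exists_cof_eq α
  -- The club consists of the suprema of the proper initial parts of a cofinal set `X`. A limit `t`
  -- of such suprema is again one, cut off at the least element of `X` above `t`.
  have hb : ∀ x : X, ∃ y, IsLUB (X ∩ Iio x.1) y := fun x =>
    exists_isLUB_of_bddAbove ⟨x.1, fun z hz => hz.2.le⟩
  choose y hy using hb
  refine ⟨range y, ⟨?_, ?_⟩, mk_range_le.trans_eq hXc⟩
  · intro T hT hT0 _ t ht
    by_cases htT : t ∈ T
    · exact hT htT
    have hne : {x | x ∈ X ∧ t ≤ x}.Nonempty := hX t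
    have hmem := wellFounded_lt.min_mem _ hne
    have hmin : ∀ z ∈ X, t ≤ z → wellFounded_lt.min _ hne ≤ z := fun z hz htz =>
      wellFounded_lt.min_le (show z ∈ {x | x ∈ X ∧ t ≤ x} from ⟨hz, htz⟩)
    generalize wellFounded_lt.min _ hne = x at hmem hmin
    refine ⟨⟨x, hmem.1⟩, (hy ⟨x, hmem.1⟩).unique ⟨?_, ?_⟩⟩
    · rintro z ⟨hzX, hzx⟩
      by_contra hc
      exact (hmin z hzX (not_le.1 hc).le).not_gt hzx
    · intro b hbb
      refine ht.2 fun s hs => ?_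
      obtain ⟨w, rfl⟩ := hT hs
      refine (hy w).2 fun z hz => hbb ⟨hz.1, ?_⟩
      have h1 : z ≤ y w := (hy w).1 hz
      have h2 : y w < t := lt_of_le_of_ne (ht.1 hs) fun h => htT (h ▸ hs)
      exact (h1.trans_lt h2).trans_le hmem.2
  · intro a
    obtain ⟨x, hx, hax⟩ := hX a
    obtain ⟨x', hx', hxx'⟩ := IsCofinal.exists_lt_mem hX x
    exact ⟨_, ⟨⟨x', hx'⟩, rfl⟩, hax.trans ((hy ⟨x', hx'⟩).1 ⟨hx, hxx'⟩)⟩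

/-- An element of a well-order of large cofinality which is a limit of a given club and whose
cofinality is a given regular cardinal. -/
theorem exists_limit_of_isCofinal {α : Type u} [LinearOrder α] [WellFoundedLT α] {s : Set α}
    (hs : IsCofinal s) {c : Cardinal.{u}} (hc : c.IsRegular) (hcα : c < Order.cof α) :
    ∃ a : α, Order.cof (Iio a) = c ∧ ∀ x < a, ∃ y ∈ s, x ≤ y ∧ y < a := by
  have := noMaxOrder_of_aleph0_le_cof (hc.aleph0_le.trans hcα.le)
  have hL : NoMaxOrder c.ord.ToType := 
    noMaxOrder_of_aleph0_le_cof (hc.aleph0_le.trans hc.cof_toType.ge)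
  obtain ⟨e, he, hes⟩ := exists_strictMono_mem_of_isCofinal (β := c.ord.ToType) hs
    fun i => (mk_Iio_ord_lt i).trans hcα
  obtain ⟨b, hb⟩ := exists_forall_lt_of_mk_index_lt_cof e (by simpa using hcα)
  obtain ⟨a, ha⟩ := exists_isLUB_of_bddAbove (s := range e)
    ⟨b, by rintro _ ⟨i, rfl⟩; exact (hb i).le⟩
  have hlt : ∀ i, e i < a := fun i => by
    obtain ⟨j, hj⟩ := exists_gt i
    exact (he hj).trans_le (ha.1 ⟨j, rfl⟩)
  have hcof : ∀ x < a, ∃ i, x ≤ e i := fun x hx => by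
    by_contra! h
    exact (ha.2 (by rintro _ ⟨i, rfl⟩; exact (h i).le)).not_gt hx
  refine ⟨a, ?_, fun x hx => ?_⟩
  · rw [← hc.cof_toType]
    refine (cof_congr_of_strictMono (f := fun i => (⟨e i, hlt i⟩ : Iio a)) (fun i j h => he h)
      ?_).symm
    rintro ⟨x, hx⟩
    obtain ⟨i, hi⟩ := hcof x hx
    exact ⟨_, ⟨i, rfl⟩, hi⟩
  · obtain ⟨i, hi⟩ := hcof x hx
    exact ⟨e i, hes i, hi, hlt i⟩

/-- An antitone function on a well-order with values in a well-order is eventually constant. -/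
theorem exists_forall_ge_eq_of_antitone {α β : Type u} [LinearOrder α] [Nonempty α] [LinearOrder β]
    [WellFoundedLT β] {f : α → β} (hf : Antitone f) : ∃ i, ∀ j, i ≤ j → f j = f i := by
  have hne : (range f).Nonempty := range_nonempty f
  obtain ⟨i, hi⟩ := wellFounded_lt.min_mem _ hne
  refine ⟨i, fun j hj => (hf hj).antisymm ?_⟩
  rw [hi]
  exact wellFounded_lt.min_le (mem_range_self j)

/-- Club guessing: if `succ c < cof α`, there are sets `C a`, without maximum and of cardinality at
least `c`, such that every club of `α` includes one of them. -/
theorem exists_clubGuessing {α : Type u} [LinearOrder α] [WellFoundedLT α] {c : Cardinal.{u}}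
    (hc : c.IsRegular) (hcα : succ c < Order.cof α) :
    ∃ C : α → Set α, ∀ D : Set α, IsClub D →
      ∃ a, C a ⊆ D ∧ c ≤ #(C a) ∧ ∀ x ∈ C a, ∃ y ∈ C a, x < y := by
  classical
  have hreg : (succ c).IsRegular := isRegular_succ hc.aleph0_le
  have hα0 : ℵ₀ < Order.cof α := (hc.aleph0_le.trans_lt (lt_succ c)).trans hcα
  have := noMaxOrder_of_aleph0_le_cof hα0.le
  have hJcof := hreg.cof_toType
  have := noMaxOrder_of_aleph0_le_cof (hreg.aleph0_le.trans hJcof.ge)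
  have := nonempty_of_aleph0_le_cof (hreg.aleph0_le.trans hJcof.ge)
  choose A hA hAc using fun a : α => exists_cof_eq (Iio a)
  -- the trace of the ladder `A a` on a set `E`
  let R : Set α → α → Set α := fun E a =>
    {z | ∃ x ∈ A a, (E ∩ Iic x.1).Nonempty ∧ IsLUB (E ∩ Iic x.1) z}
  -- If no `R E` guesses, each `E` has a club `Φ E` that defeats it. Iterating `Φ` through `c⁺`
  -- steps with intersections gives a decreasing sequence of clubs.
  by_contra! hcon
  have key : ∀ E : Set α, ∃ D : Set α, IsClub D ∧ ∀ a, R E a ⊆ D → c ≤ #(R E a) →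
      ∃ x ∈ R E a, ∀ y ∈ R E a, y ≤ x := fun E => hcon (R E)
  choose Φ hΦ hΦR using key
  let E : (succ c).ord.ToType → Set α :=
    WellFoundedLT.fix fun i IH => ⋂ j : Iio i, Φ (IH j.1 j.2)
  have hE : ∀ i, E i = ⋂ j : Iio i, Φ (E j.1) := fun i => WellFoundedLT.fix_eq _ i
  have hEclub : ∀ i, IsClub (E i) := fun i => by
    rw [hE i]
    exact IsClub.iInter hα0.ne'
      (by simpa using ((mk_Iio_ord_lt i).trans hcα)) fun j => hΦ _
  have hEanti : Antitone E := fun i j hij => by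
    rw [hE i, hE j]
    exact fun x hx => mem_iInter.2 fun k => mem_iInter.1 hx ⟨k.1, k.2.trans_le hij⟩
  have hE' : IsClub (⋂ i, Φ (E i)) := IsClub.iInter hα0.ne' (by simpa using hcα) fun j => hΦ _
  have hE'sub : ∀ i, (⋂ i, Φ (E i)) ⊆ E i := fun i => by
    rw [hE i]
    exact fun x hx => mem_iInter.2 fun k => mem_iInter.1 hx k.1
  obtain ⟨a, hacof, ha⟩ := exists_limit_of_isCofinal hE'.isCofinal hc ((lt_succ c).trans hcα)
  -- The suprema of `E i ∩ Iic x` decrease with `i`, hence stabilise. The ladder has only `c`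
  -- points, so one `i < c⁺` serves them all, and then the trace of `E i` lies in `E j ⊆ Φ (E i)`
  -- for `j > i`, against the choice of `Φ`.
  have hstab : ∀ x : A a, ∃ i, ∀ j, i ≤ j → ∀ z, (E i ∩ Iic x.1.1).Nonempty →
      IsLUB (E i ∩ Iic x.1.1) z → (E j ∩ Iic x.1.1).Nonempty ∧ IsLUB (E j ∩ Iic x.1.1) z := by
    intro x
    by_cases hne : ∀ i, (E i ∩ Iic x.1.1).Nonempty
    · have hb : ∀ i, ∃ z, IsLUB (E i ∩ Iic x.1.1) z := fun i =>
        exists_isLUB_of_bddAbove ⟨x.1.1, fun z hz => hz.2⟩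
      choose z hz using hb
      obtain ⟨i, hi⟩ := exists_forall_ge_eq_of_antitone (f := z) fun i j hij =>
        (hz j).2 fun w hw => (hz i).1 ⟨hEanti hij hw.1, hw.2⟩
      refine ⟨i, fun j hij w _ hw => ⟨hne j, ?_⟩⟩
      rw [hw.unique (hz i), ← hi j hij]
      exact hz j
    · push Not at hne
      obtain ⟨i, hi⟩ := hne
      exact ⟨i, fun j _ z h => absurd hi h.ne_empty⟩
  choose ι hι using hstab
  obtain ⟨i, hi⟩ := exists_forall_lt_of_mk_index_lt_cof ι
    (by rw [hAc, hacof, hJcof]; exact lt_succ c)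
  obtain ⟨j, hij⟩ := exists_gt i
  have hsub : R (E i) a ⊆ Φ (E i) := by
    rintro z ⟨x, hx, hne, hz⟩
    have hιi := (hi ⟨x, hx⟩).le
    have hne' : (E (ι ⟨x, hx⟩) ∩ Iic x.1).Nonempty :=
      hne.mono (inter_subset_inter_left _ (hEanti hιi))
    obtain ⟨w, hw⟩ : ∃ w, IsLUB (E (ι ⟨x, hx⟩) ∩ Iic x.1) w :=
      exists_isLUB_of_bddAbove ⟨x.1, fun z hz => hz.2⟩
    have h1 := (hι ⟨x, hx⟩ i hιi w hne' hw).2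
    have h2 := hι ⟨x, hx⟩ j (hιi.trans hij.le) w hne' hw
    rw [hz.unique h1]
    have h3 : w ∈ E j := (hEclub j).isLUB_mem inter_subset_left h2.1 h2.2
    rw [hE j] at h3
    exact mem_iInter.1 h3 ⟨i, hij⟩
  have hRlt : R (E i) a ⊆ Iio a := by
    rintro z ⟨x, hx, -, hz⟩
    exact (hz.2 fun y hy => hy.2).trans_lt x.2
  have hRcof : ∀ x < a, ∃ y ∈ R (E i) a, x ≤ y := by
    intro x hx
    obtain ⟨y, hy, hxy, hya⟩ := ha x hx
    obtain ⟨w, hw, hyw⟩ := hA a ⟨y, hya⟩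
    have hyw' : y ∈ E i ∩ Iic w.1 := ⟨hE'sub i hy, hyw⟩
    obtain ⟨z, hz⟩ : ∃ z, IsLUB (E i ∩ Iic w.1) z :=
      exists_isLUB_of_bddAbove ⟨w.1, fun z hz => hz.2⟩
    exact ⟨z, ⟨w, hw, ⟨y, hyw'⟩, hz⟩, hxy.trans (hz.1 hyw')⟩
  have hcard : c ≤ #(R (E i) a) := by
    rw [← hacof]
    have hcof' : IsCofinal (Subtype.val ⁻¹' R (E i) a : Set (Iio a)) := by
      rintro ⟨x, hx⟩
      obtain ⟨y, hy, hxy⟩ := hRcof x hx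
      exact ⟨⟨y, hRlt hy⟩, hy, hxy⟩
    exact (cof_le hcof').trans (mk_preimage_of_injective _ _ Subtype.val_injective)
  obtain ⟨x, hx, hmax⟩ := hΦR (E i) a hsub hcard
  have := noMaxOrder_of_aleph0_le_cof (hc.aleph0_le.trans hacof.ge)
  obtain ⟨y, hy⟩ := exists_gt (⟨x, hRlt hx⟩ : Iio a)
  obtain ⟨w, hw, hyw⟩ := hRcof y.1 y.2
  exact ((show x < y.1 from hy).trans_le hyw).not_ge (hmax w hw)

end WellOrders

/-! ### Sequences increasing modulo a filter -/

section Scale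

open Order Set Filter

theorem exists_mk_Iio_eq {κ c : Cardinal.{u}} (h : c < κ) : ∃ v : κ.ord.ToType, #(Iio v) = c := by
  have hlt : c.ord < Ordinal.type (α := κ.ord.ToType) (· < ·) := by simpa using h
  refine ⟨Ordinal.enum (α := κ.ord.ToType) (· < ·) ⟨c.ord, hlt⟩, ?_⟩
  have h1 := Ordinal.typein_enum (α := κ.ord.ToType) (· < ·) hlt
  have h2 := congrArg Ordinal.card h1
  rw [card_ord] at h2
  exact h2

/-- The least strict upper bound of few elements with small initial segments has a small initial
segment. -/
theorem exists_strictUpperBound_mk_Iio_le {κ c : Cardinal.{u}} (hc : ℵ₀ ≤ c) (hcκ : c < κ)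
    {s : Set κ.ord.ToType} (hs : #s ≤ c) (hsc : ∀ v ∈ s, #(Iio v) ≤ c) :
    ∃ v, #(Iio v) ≤ c ∧ ∀ x ∈ s, x < v := by
  -- This initial segment has size at most `c < κ`, so it is proper, and the least point outside it
  -- is the bound.
  have hU : #(⋃ x : s, Iic x.1 : Set κ.ord.ToType) ≤ c := by
    refine (mk_iUnion_le _).trans ?_
    refine (mul_le_mul' hs (ciSup_le' fun x => ?_ : _ ≤ c)).trans (mul_eq_self hc).le
    rw [← Iio_insert]
    exact (mk_insert_le).trans ((add_le_add (hsc x.1 x.2) (one_le_aleph0.trans hc)).trans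
      (add_eq_self hc).le)
  have hne : {v : κ.ord.ToType | ∀ x ∈ s, x < v}.Nonempty := by
    by_contra! hemp
    have : (⋃ x : s, Iic x.1 : Set κ.ord.ToType) = Set.univ := by
      refine eq_univ_of_forall fun v => ?_
      by_contra hv
      have : v ∈ {v : κ.ord.ToType | ∀ x ∈ s, x < v} := fun x hx => by
        by_contra hxv
        exact hv (mem_iUnion.2 ⟨⟨x, hx⟩, not_lt.1 hxv⟩)
      rw [hemp] at this
      exact this
    rw [this, mk_univ, mk_ord_toType] at hU
    exact hcκ.not_ge hU
  refine ⟨wellFounded_lt.min _ hne, (mk_le_mk_of_subset fun v hv => ?_).trans hU,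
    wellFounded_lt.min_mem _ hne⟩
  by_contra hv'
  refine (wellFounded_lt.min_le (x := v) (s := {v | ∀ x ∈ s, x < v}) fun x hx => ?_).not_gt hv
  by_contra hxv
  exact hv' (mem_iUnion.2 ⟨⟨x, hx⟩, not_lt.1 hxv⟩)

/-- A sequence of functions increasing modulo `l` which at every `β` uniformly dominates, on a set
of `l`, all functions indexed by the small set `E β`. -/
theorem exists_scale {κ : Cardinal.{u}} (hκ : ℵ₀ < κ) {P I : Type u} [LinearOrder P]
    [WellFoundedLT P] (hP : ∀ β : P, #(Iio β) ≤ κ) (l : Filter I) (w : I → κ.ord.ToType)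
    (hw : ∀ v, ∀ᶠ ξ in l, v < w ξ) (E : P → Set P) (hE : ∀ β, #(E β) < κ) :
    ∃ f : P → I → κ.ord.ToType, (∀ α β, α < β → ∀ᶠ ξ in l, f α ξ < f β ξ) ∧
      ∀ β, ∀ᶠ ξ in l, ∀ α ∈ E β, α < β → f α ξ < f β ξ := by
  classical
  have hj : ∀ β : P, Nonempty (Iio β ↪ κ.ord.ToType) := fun β => by
    rw [← Cardinal.le_def]
    simpa using hP β
  let j : ∀ β : P, Iio β ↪ κ.ord.ToType := fun β => (hj β).some
  let c : I → Cardinal.{u} := fun ξ => max ℵ₀ #(Iio (w ξ))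
  have hc0 : ∀ ξ, ℵ₀ ≤ c ξ := fun ξ => le_max_left _ _
  have hcκ : ∀ ξ, c ξ < κ := fun ξ => max_lt hκ (mk_Iio_ord_lt _)
  -- At coordinate `ξ`, `f β` has to exceed only the `f α` with `α ∈ B β ξ`. This set has size at
  -- most `c ξ`, yet as `w ξ` grows it catches each fixed `α < β`, and all of `E β` at once.
  let B : P → I → Set P := fun β ξ =>
    Subtype.val '' (j β ⁻¹' Iio (w ξ)) ∪ (if #(E β) ≤ c ξ then E β else ∅)
  have hBc : ∀ β ξ, #(B β ξ) ≤ c ξ := fun β ξ => by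
    refine (mk_union_le _ _).trans ((add_le_add ?_ ?_).trans (add_eq_self (hc0 ξ)).le)
    · exact mk_image_le.trans ((mk_preimage_of_injective _ _ (j β).injective).trans
        (le_max_right _ _))
    · split_ifs with h
      · exact h
      · simp
  have step : ∀ (β : P) (IH : ∀ α, α < β → I → κ.ord.ToType) (ξ : I), ∃ v : κ.ord.ToType,
      (∀ α h, #(Iio (IH α h ξ)) ≤ c ξ) →
        #(Iio v) ≤ c ξ ∧ ∀ α h, α ∈ B β ξ → IH α h ξ < v := by
    intro β IH ξ
    by_cases hIH : ∀ α h, #(Iio (IH α h ξ)) ≤ c ξ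
    · obtain ⟨v, hv, hv'⟩ := exists_strictUpperBound_mk_Iio_le (hc0 ξ) (hcκ ξ)
        (s := (fun α : {α : B β ξ // α.1 < β} => IH α.1.1 α.2 ξ) '' Set.univ)
        (by
          refine mk_image_le.trans (mk_univ.trans_le ?_)
          exact (mk_subtype_le _).trans (hBc β ξ))
        (by rintro _ ⟨α, -, rfl⟩; exact hIH _ _)
      exact ⟨v, fun _ => ⟨hv, fun α h hα => hv' _ ⟨⟨⟨α, hα⟩, h⟩, trivial, rfl⟩⟩⟩
    · exact ⟨w ξ, fun h => absurd h hIH⟩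
  choose g hg using step
  let f : P → I → κ.ord.ToType := WellFoundedLT.fix g
  have hf : ∀ β, f β = g β fun α _ => f α := fun β => WellFoundedLT.fix_eq g β
  have hfc : ∀ β ξ, #(Iio (f β ξ)) ≤ c ξ := fun β => by
    induction β using WellFoundedLT.induction with
    | ind β ih =>
      intro ξ
      rw [hf β]
      exact (hg β (fun α _ => f α) ξ fun α h => ih α h ξ).1
  have hflt : ∀ α β ξ, α < β → α ∈ B β ξ → f α ξ < f β ξ := fun α β ξ h hα => by
    rw [hf β]
    exact (hg β (fun α _ => f α) ξ fun α h => hfc α ξ).2 α h hα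
  refine ⟨f, fun α β h => ?_, fun β => ?_⟩
  · filter_upwards [hw (j β ⟨α, h⟩)] with ξ hξ
    exact hflt α β ξ h (Or.inl ⟨⟨α, h⟩, hξ, rfl⟩)
  · obtain ⟨v, hv⟩ := exists_mk_Iio_eq (hE β)
    filter_upwards [hw v] with ξ hξ α hα h
    refine hflt α β ξ h (Or.inr ?_)
    have : #(E β) ≤ c ξ := by
      rw [← hv]
      exact (mk_le_mk_of_subset (Iio_subset_Iio hξ.le)).trans (le_max_right _ _)
    rwa [if_pos this]

end Scale

/-! ### Projections to small sets stabilise -/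

section Projection

open Order Set Filter

/-- The least element of `s` which is at least `v` (and `v` itself if there is none). -/
noncomputable def leastGE {V : Type u} [LinearOrder V] [WellFoundedLT V] (s : Set V) (v : V) : V :=
  open Classical in
  if h : (s ∩ Ici v).Nonempty then wellFounded_lt.min (s ∩ Ici v) h else v

section LeastGE

variable {V : Type u} [LinearOrder V] [WellFoundedLT V] {s : Set V} {v w x : V}

theorem le_leastGE : v ≤ leastGE s v := by
  unfold leastGE
  split_ifs with h
  · exact (wellFounded_lt.min_mem _ h).2
  · exact le_rfl

theorem leastGE_le (hx : x ∈ s) (hv : v ≤ x) : leastGE s v ≤ x := by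
  have h : (s ∩ Ici v).Nonempty := ⟨x, hx, hv⟩
  unfold leastGE
  rw [dif_pos h]
  exact wellFounded_lt.min_le (show x ∈ s ∩ Ici v from ⟨hx, hv⟩)

theorem leastGE_mem [OrderTop V] (hs : ⊤ ∈ s) : leastGE s v ∈ s := by
  have h : (s ∩ Ici v).Nonempty := ⟨⊤, hs, le_top⟩
  unfold leastGE
  rw [dif_pos h]
  exact (wellFounded_lt.min_mem _ h).1

theorem leastGE_mono [OrderTop V] (hs : ⊤ ∈ s) (h : v ≤ w) : leastGE s v ≤ leastGE s w :=
  leastGE_le (leastGE_mem hs) (h.trans le_leastGE)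

end LeastGE

/-- A recursion along a well-order with continuous values: `e i` is the least upper bound of the
values chosen from the proper initial parts of `e`. -/
theorem exists_isLUB_recursion {N P : Type u} [LinearOrder N] [WellFoundedLT N] [LinearOrder P]
    [WellFoundedLT P] (hNP : #N < Order.cof P) (G : N → (N → P) → P)
    (hG : ∀ i H H', (∀ k ≤ i, H k = H' k) → G i H = G i H') :
    ∃ e : N → P, ∀ i, IsLUB ((fun j => G j e) '' Iio i) (e i) := by
  classical
  have hP0 : Nonempty P := by
    rw [← cof_ne_zero_iff]
    exact (bot_le.trans_lt hNP).ne'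
  have key : ∀ (i : N) (IH : ∀ k, k < i → P), ∃ x,
      IsLUB (range fun j : Iio i => G j.1 fun k => if h : k ≤ j.1 then IH k (h.trans_lt j.2)
        else hP0.some) x := by
    intro i IH
    refine exists_isLUB_of_bddAbove ?_
    obtain ⟨x, hx⟩ := exists_forall_lt_of_mk_index_lt_cof (fun j : Iio i => G j.1 fun k =>
      if h : k ≤ j.1 then IH k (h.trans_lt j.2) else hP0.some) ((mk_set_le _).trans_lt hNP)
    exact ⟨x, by rintro _ ⟨j, rfl⟩; exact (hx j).le⟩
  choose g hg using key
  let e : N → P := WellFoundedLT.fix g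
  have he : ∀ i, e i = g i fun j _ => e j := fun i => WellFoundedLT.fix_eq g i
  refine ⟨e, fun i => ?_⟩
  rw [he i]
  convert hg i fun j _ => e j using 1
  ext x
  constructor
  · rintro ⟨j, hj, rfl⟩
    exact ⟨⟨j, hj⟩, hG _ _ _ fun k hk => by simp [hk]⟩
  · rintro ⟨j, rfl⟩
    exact ⟨j.1, j.2, (hG _ _ _ fun k hk => by simp [hk])⟩

/-- A sequence growing as fast as prescribed which, along one of the guessing sets, has uniform
bounds for its initial parts. -/
theorem exists_guided_sequence {N P I V : Type u} [LinearOrder N] [WellFoundedLT N] [LinearOrder P]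
    [WellFoundedLT P] [LinearOrder V] (hN : ℵ₀ < Order.cof N) (hNP : #N < Order.cof P)
    {l : Filter I} {f : P → I → V} (hf : ∀ α β, α ≤ β → ∀ᶠ ξ in l, f α ξ ≤ f β ξ)
    (hclub : ∀ δ : P, Order.cof (Iio δ) = Order.cof N →
      ∃ E : Set (Iio δ), IsClub E ∧ ∀ᶠ ξ in l, ∀ α ∈ E, f α.1 ξ ≤ f δ ξ)
    {C : N → Set N} {R : N → Prop} (hC : ∀ D : Set N, IsClub D → ∃ a, C a ⊆ D ∧ R a)
    (nxt : P → P) (hnxt : ∀ α, α < nxt α) :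
    ∃ (a : N) (e η : N → P), R a ∧ (∀ i, e i ≤ η i) ∧ (∀ i j, i < j → nxt (η i) ≤ e j) ∧
      ∀ i ∈ C a, ∀ᶠ ξ in l, ∀ k ∈ C a, k ≤ i → f (e k) ξ ≤ f (η i) ξ := by
  classical
  have hNmax : NoMaxOrder N := noMaxOrder_of_aleph0_le_cof hN.le
  have hN0 : Nonempty N := nonempty_of_aleph0_le_cof hN.le
  have hPω : ℵ₀ ≤ Order.cof P := hN.le.trans ((cof_le_cardinalMk N).trans hNP.le)
  -- `Bd a i H η`: the values of `f ∘ H` on `C a` up to `i` are uniformly bounded by `f η`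
  let Bd : N → N → (N → P) → P → Prop := fun a i H η =>
    ∀ᶠ ξ in l, ∀ k ∈ C a, k ≤ i → f (H k) ξ ≤ f η ξ
  have hBdcongr : ∀ a i H H', (∀ k ≤ i, H k = H' k) → Bd a i H = Bd a i H' := by
    intro a i H H' h
    funext η
    refine propext (eventually_congr (Eventually.of_forall fun ξ => ?_))
    refine forall_congr' fun k => forall_congr' fun _ => forall_congr' fun hk => ?_
    rw [h k hk]
  -- The guessed index `a` is not yet known, so `η` is put above a witness for every `a` that has
  -- one; this is possible since `#N < cof P`.
  have hηex : ∀ (x : P) (T : N → P → Prop), ∃ η, x ≤ η ∧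
      ∀ a, (∃ y, T a y) → ∃ y, T a y ∧ y ≤ η := by
    intro x T
    have : ∀ a, ∃ y, (∃ y, T a y) → T a y := fun a => by
      by_cases h : ∃ y, T a y
      · exact ⟨h.choose, fun _ => h.choose_spec⟩
      · exact ⟨x, fun h' => absurd h' h⟩
    choose y hy using this
    obtain ⟨b, hb⟩ := exists_forall_lt_of_mk_index_lt_cof y hNP
    exact ⟨max x b, le_max_left _ _, fun a ha => ⟨y a, hy a ha, (hb a).le.trans (le_max_right _ _)⟩⟩
  choose η0 hη0 hη0' using hηex
  let η1 : N → (N → P) → P := fun i H => η0 (H i) fun a => Bd a i H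
  obtain ⟨e, he⟩ := exists_isLUB_recursion hNP (fun i H => nxt (η1 i H)) (by
    intro i H H' h
    have h1 : (fun a => Bd a i H) = fun a => Bd a i H' := funext fun a => hBdcongr a i H H' h
    simp only [η1, h1, h i le_rfl])
  have hη : ∀ i, e i ≤ η1 i e := fun i => hη0 _ _
  have hlt : ∀ i j, i < j → nxt (η1 i e) ≤ e j := fun i j hij => (he j).1 ⟨i, hij, rfl⟩
  have hstrict : StrictMono e := fun i j hij =>
    ((hη i).trans_lt (hnxt _)).trans_le (hlt i j hij)
  -- the supremum of the sequence
  obtain ⟨δ, hδ⟩ : ∃ δ, IsLUB (range e) δ := by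
    obtain ⟨b, hb⟩ := exists_forall_lt_of_mk_index_lt_cof e hNP
    exact exists_isLUB_of_bddAbove ⟨b, by rintro _ ⟨i, rfl⟩; exact (hb i).le⟩
  have heδ : ∀ i, e i < δ := fun i => by
    obtain ⟨j, hj⟩ := exists_gt i
    exact (hstrict hj).trans_le (hδ.1 ⟨j, rfl⟩)
  have hcofinal : ∀ x < δ, ∃ i, x < e i := fun x hx => by
    by_contra! h
    exact (hδ.2 (by rintro _ ⟨i, rfl⟩; exact h i)).not_gt hx
  let e' : N → Iio δ := fun i => ⟨e i, heδ i⟩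
  have he' : IsNormal e' := by
    refine ⟨fun i j h => hstrict h, fun {i} hi => ?_⟩
    intro b hb
    refine (he i).2 ?_
    rintro _ ⟨j, hj, rfl⟩
    obtain ⟨k, hk, hki⟩ := (hi.lt_iff_exists_lt).1 hj
    exact (hlt j k hki).trans (hb ⟨k, hk, rfl⟩)
  have hcofδ : Order.cof (Iio δ) = Order.cof N := by
    refine (cof_congr_of_strictMono he'.strictMono ?_).symm
    rintro ⟨x, hx⟩
    obtain ⟨i, hi⟩ := hcofinal x hx
    exact ⟨_, ⟨i, rfl⟩, hi.le⟩
  obtain ⟨E, hE, hEf⟩ := hclub δ hcofδ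
  have hrange : IsClub (range e') := by
    refine ⟨fun T hT hT0 _ x hx => ?_, ?_⟩
    · obtain ⟨i, hi⟩ := hcofinal x.1 x.2
      have hTi : ∀ j ∈ e' ⁻¹' T, j ≤ i := fun j hj => by
        have h1 : e' j < e' i := lt_of_le_of_lt (hx.1 hj) hi
        exact (he'.strictMono.lt_iff_lt.1 h1).le
      obtain ⟨s, hs⟩ := exists_isLUB_of_bddAbove (s := e' ⁻¹' T) ⟨i, hTi⟩
      have hTe : e' '' (e' ⁻¹' T) = T := image_preimage_eq_of_subset hT
      have h2 := he'.map_isLUB hs (by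
        obtain ⟨y, hy⟩ := hT0
        obtain ⟨j, rfl⟩ := hT hy
        exact ⟨j, hy⟩)
      rw [hTe] at h2
      exact ⟨s, h2.unique hx⟩
    · rintro ⟨x, hx⟩
      obtain ⟨i, hi⟩ := hcofinal x hx
      exact ⟨_, ⟨i, rfl⟩, hi.le⟩
  have hD : IsClub (e' ⁻¹' E) := by
    refine ⟨fun T hT hT0 _ x hx => ?_, fun i => ?_⟩
    · exact hE.isLUB_mem (image_subset_iff.2 hT) (hT0.image _) (he'.map_isLUB hx hT0)
    · obtain ⟨y, hy, hiy⟩ := (hE.inter (by rw [hcofδ]; exact hN.ne') hrange).isCofinal (e' i)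
      obtain ⟨j, rfl⟩ := hy.2
      exact ⟨j, hy.1, he'.strictMono.le_iff_le.1 hiy⟩
  obtain ⟨a, haD, haR⟩ := hC _ hD
  refine ⟨a, e, fun i => η1 i e, haR, hη, hlt, fun i _ => ?_⟩
  -- Since `C a` lies in the pulled-back club, `f δ` is a uniform bound. Some bound therefore
  -- exists, and the `η` chosen at stage `i`, before `δ` was known, already lies above one.
  obtain ⟨y, hy, hyη⟩ := hη0' (e i) (fun a => Bd a i e) a
    ⟨δ, hEf.mono fun ξ hξ k hk _ => hξ (e' k) (haD hk)⟩
  filter_upwards [hy, hf _ _ hyη] with ξ h1 h2 k hk hki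
  exact (h1 k hk hki).trans h2

/-- If a sequence increasing modulo a filter has, at every limit of small cofinality, a uniform
bound along a club, then its projection to small sets stabilises. -/
theorem exists_leastGE_stable {κ : Cardinal.{u}} (hκ0 : ℵ₀ < κ) (hκ : ∀ c < κ, succ c < κ)
    {P I V : Type u} [LinearOrder P] [WellFoundedLT P] [LinearOrder V] [WellFoundedLT V]
    [OrderTop V] (hP : κ < Order.cof P) (hI : #I < κ) {l : Filter I} {f : P → I → V}
    (hf : ∀ α β, α ≤ β → ∀ᶠ ξ in l, f α ξ ≤ f β ξ)
    (hclub : ∀ δ : P, ℵ₀ ≤ Order.cof (Iio δ) → Order.cof (Iio δ) < κ →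
      ∃ E : Set (Iio δ), IsClub E ∧ ∀ᶠ ξ in l, ∀ α ∈ E, f α.1 ξ ≤ f δ ξ)
    {S : I → Set V} {c : Cardinal.{u}} (hc : c < κ) (hS : ∀ ξ, #(S ξ) ≤ c) (htop : ∀ ξ, ⊤ ∈ S ξ) :
    ∃ α, ∀ β, α ≤ β → ∀ᶠ ξ in l, leastGE (S ξ) (f β ξ) = leastGE (S ξ) (f α ξ) := by
  classical
  by_contra! hcon
  have hmono : ∀ α β, α ≤ β → ∀ᶠ ξ in l, leastGE (S ξ) (f α ξ) ≤ leastGE (S ξ) (f β ξ) :=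
    fun α β h => (hf α β h).mono fun ξ hξ => leastGE_mono (htop ξ) hξ
  have hcon' : ∀ α, ∃ β, α < β ∧ ∃ᶠ ξ in l, leastGE (S ξ) (f α ξ) < leastGE (S ξ) (f β ξ) := by
    intro α
    obtain ⟨β, hαβ, hβ⟩ := hcon α
    refine ⟨β, lt_of_le_of_ne hαβ ?_, ?_⟩
    · rintro rfl
      simp at hβ
    · exact (hβ.and_eventually (hmono α β hαβ)).mono fun ξ hξ => lt_of_le_of_ne hξ.2 hξ.1.symm
  choose nxt hnxt hnxt' using hcon'
  -- the cardinals used for guessing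
  obtain ⟨d, hd⟩ : ∃ d, d = max ℵ₀ (max c #I) := ⟨_, rfl⟩
  have hd0 : ℵ₀ ≤ d := hd ▸ le_max_left _ _
  have hdc : c ≤ d := hd ▸ (le_max_left _ _).trans (le_max_right _ _)
  have hdI : #I ≤ d := hd ▸ (le_max_right _ _).trans (le_max_right _ _)
  have hdκ : d < κ := hd ▸ max_lt hκ0 (max_lt hc hI)
  have hreg1 : (succ d).IsRegular := isRegular_succ hd0
  have hreg : (succ (succ (succ d))).IsRegular :=
    isRegular_succ ((hreg1.aleph0_le.trans (le_succ _)))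
  -- Guessing sets of size `d⁺` exceed the at most `d` pairs `(ξ, s)` with `s ∈ S ξ`, and guessing
  -- them on `ν` needs `d⁺⁺ < ν`.
  obtain ⟨ν, hν⟩ : ∃ ν, ν = succ (succ (succ d)) := ⟨_, rfl⟩
  rw [← hν] at hreg
  have hνκ : ν < κ := hν ▸ hκ _ (hκ _ (hκ _ hdκ))
  have hNcof : Order.cof ν.ord.ToType = ν := hreg.cof_toType
  have hNω : ℵ₀ < ν := hν ▸ hd0.trans_lt
    ((lt_succ d).trans ((lt_succ _).trans (lt_succ _)))
  have hNP : #ν.ord.ToType < Order.cof P := by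
    rw [mk_ord_toType]
    exact hνκ.trans hP
  obtain ⟨C, hC⟩ := exists_clubGuessing (α := ν.ord.ToType) hreg1
    (by rw [hNcof, hν]; exact lt_succ _)
  obtain ⟨a, e, η, ⟨hCcard, hCmax⟩, heη, hηe, hbd⟩ := exists_guided_sequence
    (by rw [hNcof]; exact hNω) hNP hf
    (fun δ hδ => hclub δ (by rw [hδ, hNcof]; exact hNω.le) (by rw [hδ, hNcof]; exact hνκ))
    hC nxt hnxt
  have hsucc : ∀ i : C a, ∃ i' ∈ C a, i.1 < i' ∧ ∀ j ∈ C a, i.1 < j → i' ≤ j := by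
    intro i
    have hne : (C a ∩ Ioi i.1).Nonempty := hCmax i.1 i.2
    have hm := wellFounded_lt.min_mem _ hne
    exact ⟨_, hm.1, hm.2, fun j hj hij =>
      wellFounded_lt.min_le (show j ∈ C a ∩ Ioi i.1 from ⟨hj, hij⟩)⟩
  choose σ hσC hσ hσmin using hsucc
  have hξ : ∀ i : C a, ∃ ξ, (∀ k ∈ C a, k ≤ i.1 → f (e k) ξ ≤ f (η i.1) ξ) ∧
      leastGE (S ξ) (f (η i.1) ξ) < leastGE (S ξ) (f (e (σ i)) ξ) := by
    intro i
    obtain ⟨ξ, h1, h2, h3⟩ := ((hnxt' (η i.1)).and_eventually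
      ((hbd i.1 i.2).and (hmono _ _ (hηe _ _ (hσ i))))).exists
    exact ⟨ξ, h2, h1.trans_le h3⟩
  choose ξ hξ1 hξ2 using hξ
  -- For `i < j` in `C a` with the same `ξ`, the projection of `f (η i)` lies strictly below that of
  -- `f (e (σ i))`, which is at most that of `f (η j)` because `σ i ≤ j`.
  have hinj : Function.Injective fun i : C a =>
      (⟨ξ i, ⟨_, leastGE_mem (v := f (η i.1) (ξ i)) (htop (ξ i))⟩⟩ : Σ x : I, S x) := by
    refine Function.Injective.of_lt_imp_ne fun i j hij h => ?_
    have h1 : ξ i = ξ j := congrArg Sigma.fst h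
    have h2 : leastGE (S (ξ i)) (f (η i.1) (ξ i)) = leastGE (S (ξ j)) (f (η j.1) (ξ j)) :=
      congrArg (fun z : Σ x : I, S x => z.2.1) h
    have h3 := hξ2 i
    rw [h2, h1] at h3
    refine h3.not_ge (leastGE_mono (htop _) (hξ1 j _ (hσC i) (hσmin i j.1 j.2 hij)))
  have hle := (mk_le_of_injective hinj).trans_eq (mk_sigma _)
  have h1 : (Cardinal.sum fun x => #(S x)) ≤ d :=
    (Cardinal.sum_le_sum _ (fun _ => d) fun x => (hS x).trans hdc).trans
      (by simpa using (mul_le_mul' hdI le_rfl).trans (mul_eq_self hd0).le)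
  exact (lt_succ d).not_ge (hCcard.trans (hle.trans h1))

end Projection

/-! ### Exact upper bounds and their cofinalities -/

section ExactUpperBound

open Order Set Filter

theorem mk_insert_range_le {V ι : Type u} {c : Cardinal.{u}} (hc : ℵ₀ ≤ c) (hι : #ι ≤ c) (x : V)
    (u : ι → V) : #(insert x (range u) : Set V) ≤ c :=
  mk_insert_le.trans ((add_le_add (mk_range_le.trans hι) (one_le_aleph0.trans hc)).trans
    (add_eq_self hc).le)

/-- A sequence whose projections to families of at most `#I`-sized sets stabilise has an exact
upper bound. -/
theorem exists_exactUpperBound {P I V : Type u} [LinearOrder P] [LinearOrder V] [WellFoundedLT V]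
    [OrderTop V] [Infinite I] (hP : succ #I < Order.cof P) {l : Filter I} {f : P → I → V}
    (hst : ∀ S : I → Set V, (∀ ξ, #(S ξ) ≤ #I) → (∀ ξ, ⊤ ∈ S ξ) →
      ∃ α, ∀ β, α ≤ β → ∀ᶠ ξ in l, leastGE (S ξ) (f β ξ) = leastGE (S ξ) (f α ξ))
    (hf : ∀ α β, α ≤ β → ∀ᶠ ξ in l, f α ξ ≤ f β ξ) :
    ∃ g : I → V, (∀ α, ∀ᶠ ξ in l, f α ξ ≤ g ξ) ∧
      ∀ h : I → V, (∀ᶠ ξ in l, h ξ < g ξ) → ∃ α, ∀ᶠ ξ in l, h ξ < f α ξ := by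
  classical
  by_contra! hcon
  have hI : ℵ₀ ≤ #I := aleph0_le_mk I
  have hP0 : Nonempty P := nonempty_of_aleph0_le_cof ((hI.trans (le_succ _)).trans hP.le)
  have key : ∀ S : I → Set V, ∃ (u : I → V) (α : P), (∀ ξ, #(S ξ) ≤ #I) → (∀ ξ, ⊤ ∈ S ξ) →
      ∀ β, α ≤ β → (∀ᶠ ξ in l, u ξ < leastGE (S ξ) (f β ξ)) ∧ ∃ᶠ ξ in l, f β ξ ≤ u ξ := by
    intro S
    by_cases hS : (∀ ξ, #(S ξ) ≤ #I) ∧ ∀ ξ, ⊤ ∈ S ξ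
    · obtain ⟨α, hα⟩ := hst S hS.1 hS.2
      obtain ⟨h, hh, hh'⟩ := hcon (fun ξ => leastGE (S ξ) (f α ξ)) fun β => by
        filter_upwards [hf β _ (le_max_right α β), hα _ (le_max_left α β)] with ξ h1 h2
        rw [← h2]
        exact h1.trans le_leastGE
      refine ⟨h, α, fun _ _ β hβ => ⟨?_, hh' β⟩⟩
      filter_upwards [hh, hα β hβ] with ξ h1 h2
      rwa [h2]
    · exact ⟨fun _ => ⊤, hP0.some, fun h1 h2 => absurd ⟨h1, h2⟩ hS⟩
  choose Φ A hΦ using key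
  -- Each stable projection is an upper bound that fails to be exact, as `u i` witnesses; adding `u
  -- i` to the later sets refines the projection. Past all `A (S i)`, infinitely many `i` share a
  -- coordinate `x`, where the values `u i x` strictly descend.
  let u : (succ #I).ord.ToType → I → V :=
    WellFoundedLT.fix fun i IH => Φ fun ξ => insert ⊤ (range fun j : Iio i => IH j.1 j.2 ξ)
  let S : (succ #I).ord.ToType → I → Set V := fun i ξ =>
    insert ⊤ (range fun j : Iio i => u j.1 ξ)
  have hu : ∀ i, u i = Φ (S i) := fun i => WellFoundedLT.fix_eq _ i
  have hS : ∀ i ξ, #(S i ξ) ≤ #I := fun i ξ =>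
    mk_insert_range_le hI (lt_succ_iff.1 (mk_Iio_ord_lt i)) _ _
  obtain ⟨β, hβ⟩ := exists_forall_lt_of_mk_index_lt_cof (fun i => A (S i))
    (by rwa [mk_ord_toType])
  have hξ : ∀ i, ∃ ξ, f β ξ ≤ u i ξ ∧ u i ξ < leastGE (S i ξ) (f β ξ) := by
    intro i
    have := hΦ (S i) (hS i) (fun ξ => mem_insert _ _) β (hβ i).le
    rw [← hu i] at this
    exact (this.2.and_eventually this.1).exists
  choose ξ hξ1 hξ2 using hξ
  have hJ : Infinite (succ #I).ord.ToType := by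
    rw [infinite_iff, mk_ord_toType]
    exact hI.trans (le_succ _)
  obtain ⟨x, hx⟩ := exists_infinite_fiber ξ (by rw [mk_ord_toType]; exact lt_succ _)
  have hanti : StrictAnti fun i : (ξ ⁻¹' {x} : Set _) => u i.1 x := by
    rintro ⟨i, rfl⟩ ⟨j, hj⟩ hij
    have h1 := hξ2 j
    have h2 := hξ1 i
    rw [show ξ j = ξ i from hj] at h1
    exact h1.trans_le (leastGE_le (mem_insert_of_mem _ ⟨⟨i, hij⟩, rfl⟩) h2)
  have := hanti.wellFoundedGT
  exact hx.not_finite (Finite.of_wellFoundedLT_wellFoundedGT _)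

/-- The exact upper bound has large cofinality almost everywhere. -/
theorem eventually_lt_cof_Iio_of_exactUpperBound {P I V : Type u} [LinearOrder P] [LinearOrder V]
    [WellFoundedLT V] [OrderTop V] {c : Cardinal.{u}} (hc : ℵ₀ ≤ c) {l : Filter I}
    {f : P → I → V}
    (hst : ∀ S : I → Set V, (∀ ξ, #(S ξ) ≤ c) → (∀ ξ, ⊤ ∈ S ξ) →
      ∃ α, ∀ β, α ≤ β → ∀ᶠ ξ in l, leastGE (S ξ) (f β ξ) = leastGE (S ξ) (f α ξ))
    (hf : ∀ α β, α ≤ β → ∀ᶠ ξ in l, f α ξ ≤ f β ξ) {g : I → V}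
    (hg : ∀ α, ∀ᶠ ξ in l, f α ξ < g ξ)
    (hexact : ∀ h : I → V, (∀ᶠ ξ in l, h ξ < g ξ) → ∃ α, ∀ᶠ ξ in l, h ξ < f α ξ) :
    ∀ᶠ ξ in l, c < Order.cof (Iio (g ξ)) := by
  classical
  by_contra hcon
  choose X hX hXc using fun ξ => exists_cof_eq (Iio (g ξ))
  -- Where `cof (g ξ) ≤ c`, projecting to a cofinal subset of `g ξ` keeps `f α ξ` below `g ξ`. By
  -- exactness some later `f β` exceeds this projection, which contradicts its stability.
  let S : I → Set V := fun ξ =>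
    if Order.cof (Iio (g ξ)) ≤ c then insert ⊤ (range fun y : X ξ => y.1.1) else {⊤}
  have hS : ∀ ξ, #(S ξ) ≤ c := fun ξ => by
    by_cases h : Order.cof (Iio (g ξ)) ≤ c
    · simp only [S, if_pos h]
      exact mk_insert_range_le hc ((hXc ξ).trans_le h) _ _
    · simp only [S, if_neg h, mk_singleton]
      exact one_le_aleph0.trans hc
  have hStop : ∀ ξ, ⊤ ∈ S ξ := fun ξ => by
    by_cases h : Order.cof (Iio (g ξ)) ≤ c <;> simp [S, h]
  obtain ⟨α, hα⟩ := hst S hS hStop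
  obtain ⟨β, hβ⟩ := hexact (fun ξ => if leastGE (S ξ) (f α ξ) < g ξ then leastGE (S ξ) (f α ξ)
    else f α ξ) (by
      filter_upwards [hg α] with ξ hξ
      split_ifs with h
      · exact h
      · exact hξ)
  refine hcon ?_
  filter_upwards [hg α, hβ, hα _ (le_max_left α β), hf β _ (le_max_right α β)] with ξ h1 h2 h3 h4
  by_contra! hle
  obtain ⟨y, hy, hy'⟩ := hX ξ ⟨f α ξ, h1⟩
  have hlt : leastGE (S ξ) (f α ξ) < g ξ := by
    refine (leastGE_le (x := y.1) ?_ hy').trans_lt y.2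
    simp only [S, if_pos hle]
    exact mem_insert_of_mem _ ⟨⟨y, hy⟩, rfl⟩
  rw [if_pos hlt] at h2
  exact (h2.trans_le (h4.trans le_leastGE)).ne' h3

end ExactUpperBound

/-! ### The avoiding family and the lower bound -/

section Invariants

open Order Set Filter

theorem isRegular_orderCof {α : Type u} [LinearOrder α] [WellFoundedLT α]
    (h : ℵ₀ ≤ Order.cof α) : (Order.cof α).IsRegular :=
  ⟨h, (Order.cof_ord_cof α).ge⟩

/-- At a singular cardinal `κ` there is a sequence of length `κ⁺` with an exact upper bound whose
cofinalities tend to `κ`. -/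
theorem exists_scale_with_exactUpperBound {κ : Cardinal.{u}} (hκ : κ.IsSingular) {I : Type u}
    [Infinite I] (hI : #I < κ) {l : Filter I} (w : I → κ.ord.ToType)
    (hw : ∀ v, ∀ᶠ ξ in l, v < w ξ) :
    ∃ (f : (succ κ).ord.ToType → I → κ.ord.ToType) (g : I → WithTop κ.ord.ToType),
      (∀ α, ∀ᶠ ξ in l, (f α ξ : WithTop κ.ord.ToType) < g ξ) ∧
      (∀ h : I → WithTop κ.ord.ToType, (∀ᶠ ξ in l, h ξ < g ξ) →
        ∃ α, ∀ᶠ ξ in l, h ξ < f α ξ) ∧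
      ∀ c < κ, ∀ᶠ ξ in l, c < Order.cof (Iio (g ξ)) := by
  classical
  have hκ0 : ℵ₀ < κ := lt_of_le_of_ne hκ.aleph0_le
    (by rintro rfl; exact not_isSingular_aleph0 hκ)
  have hsucc : ∀ c < κ, succ c < κ := fun c hc => hκ.isSuccLimit.succ_lt hc
  have hreg : (succ κ).IsRegular := isRegular_succ hκ.aleph0_le
  have hPcof : Order.cof (succ κ).ord.ToType = succ κ := hreg.cof_toType
  have hPmax : NoMaxOrder (succ κ).ord.ToType :=
    noMaxOrder_of_aleph0_le_cof (hreg.aleph0_le.trans hPcof.ge)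
  have hP : κ < Order.cof (succ κ).ord.ToType := by rw [hPcof]; exact lt_succ κ
  have hEex : ∀ δ : (succ κ).ord.ToType, ∃ E : Set (Iio δ), #E < κ ∧
      (ℵ₀ ≤ Order.cof (Iio δ) → Order.cof (Iio δ) < κ → IsClub E) := by
    intro δ
    by_cases h : ℵ₀ ≤ Order.cof (Iio δ) ∧ Order.cof (Iio δ) < κ
    · have := noMaxOrder_of_aleph0_le_cof h.1
      obtain ⟨E, hE, hEc⟩ := exists_isClub_mk_le_cof (Iio δ)
      exact ⟨E, hEc.trans_lt h.2, fun _ _ => hE⟩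
    · exact ⟨∅, by simpa using hκ.pos, fun h1 h2 => absurd ⟨h1, h2⟩ h⟩
  choose E hEc hE using hEex
  obtain ⟨f, hf, hfE⟩ := exists_scale hκ0 (fun β => lt_succ_iff.1 (mk_Iio_ord_lt β)) l w hw
    (fun δ => Subtype.val '' E δ) (fun δ => mk_image_le.trans_lt (hEc δ))
  have hf' : ∀ α β, α ≤ β → ∀ᶠ ξ in l,
      (f α ξ : WithTop κ.ord.ToType) ≤ (f β ξ : WithTop κ.ord.ToType) := fun α β h => by
    rcases h.eq_or_lt with rfl | h
    · exact Eventually.of_forall fun _ => le_rfl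
    · exact (hf α β h).mono fun ξ hξ => WithTop.coe_le_coe.2 hξ.le
  have hst : ∀ c < κ, ∀ S : I → Set (WithTop κ.ord.ToType), (∀ ξ, #(S ξ) ≤ c) →
      (∀ ξ, ⊤ ∈ S ξ) → ∃ α, ∀ β, α ≤ β → ∀ᶠ ξ in l,
        leastGE (S ξ) (f β ξ : WithTop κ.ord.ToType) = leastGE (S ξ) (f α ξ) := by
    intro c hc S hS htop
    refine exists_leastGE_stable hκ0 hsucc hP hI hf' (fun δ h1 h2 => ⟨E δ, hE δ h1 h2, ?_⟩) hc hS
      htop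
    filter_upwards [hfE δ] with ξ hξ α hα
    exact WithTop.coe_le_coe.2 (hξ α.1 ⟨α, hα, rfl⟩ α.2).le
  obtain ⟨g, hg, hexact⟩ := exists_exactUpperBound
    ((succ_le_of_lt hI).trans_lt hP) (hst _ hI) hf'
  have hg' : ∀ α, ∀ᶠ ξ in l, (f α ξ : WithTop κ.ord.ToType) < g ξ := fun α => by
    obtain ⟨β, hβ⟩ := exists_gt α
    filter_upwards [hf α β hβ, hg β] with ξ h1 h2
    exact (WithTop.coe_lt_coe.2 h1).trans_le h2
  refine ⟨f, g, hg', hexact, fun c hc => ?_⟩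
  refine (eventually_lt_cof_Iio_of_exactUpperBound (le_max_left ℵ₀ c)
    (hst _ (max_lt hκ0 hc)) hf' hg' hexact).mono fun ξ hξ => (le_max_right _ _).trans_lt hξ

/-- A family of `κ⁺` functions eventually avoiding every slalom of bounded width. -/
theorem exists_isEventuallyAvoiding {κ θ : Cardinal.{u}} (hκ : κ.IsSingular) (hθ : θ < κ) :
    ∃ F : Set (CardInv.Idx κ → CardInv.Idx κ), CardInv.IsEventuallyAvoiding κ θ F ∧
      #F ≤ succ κ := by
  classical
  have hκ0 : ℵ₀ < κ := lt_of_le_of_ne hκ.aleph0_le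
    (by rintro rfl; exact not_isSingular_aleph0 hκ)
  have hKcof0 : ℵ₀ ≤ Order.cof κ.ord.ToType := by
    rw [Ordinal.cof_toType, Ordinal.aleph0_le_cof_iff, Ordinal.one_lt_cof_iff]
    exact isSuccLimit_ord hκ.aleph0_le
  have hKmax := noMaxOrder_of_aleph0_le_cof hKcof0
  have hK0 := nonempty_of_aleph0_le_cof hKcof0
  obtain ⟨A, hA, hAc⟩ := exists_cof_eq κ.ord.ToType
  have hAκ : #A < κ := by
    rw [hAc, Ordinal.cof_toType]
    exact hκ.cof_ord_lt
  have hAinf : Infinite A := by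
    rw [infinite_iff, hAc]
    exact hKcof0
  have hA0 : Nonempty A := hA.nonempty.to_subtype
  have hAlt : ∀ v : κ.ord.ToType, ∃ a : A, v < a.1 := fun v => by
    obtain ⟨a, ha, hva⟩ := IsCofinal.exists_lt_mem hA v
    exact ⟨⟨a, ha⟩, hva⟩
  obtain ⟨f, g, hfg, hexact, hcof⟩ := exists_scale_with_exactUpperBound hκ hAκ (l := atTop)
    (fun a : A => a.1) (fun v => by
      obtain ⟨a, ha⟩ := hAlt v
      exact (eventually_ge_atTop a).mono fun b hb => ha.trans_le hb)
  -- the block of an index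
  have he : ∀ z : A, ∃ n : A, z ≤ n ∧ max ℵ₀ (max #(Iio z.1) (max θ #A)) < Order.cof (Iio (g n)) :=
    fun z => ((eventually_ge_atTop z).and (hcof _ (max_lt hκ0 (max_lt (mk_Iio_ord_lt _)
      (max_lt hθ hAκ))))).exists
  choose e hze he using he
  choose q hq using hAlt
  let p : κ.ord.ToType → A := fun i => e (q i)
  have hp : ∀ i, i < (p i).1 := fun i => (hq i).trans_le (hze _)
  refine ⟨range fun α i => f α (p i), ?_, mk_range_le.trans_eq (mk_ord_toType _)⟩
  intro S hS
  let T : A → Set (WithTop κ.ord.ToType) := fun n => ⋃ i : p ⁻¹' {n}, (↑) '' S i.1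
  have hpcard : ∀ z, #(p ⁻¹' {e z}) < Order.cof (Iio (g (e z))) := by
    intro z
    have hreg := isRegular_orderCof ((le_max_left _ _).trans (he z).le)
    have hsub : p ⁻¹' {e z} ⊆ ⋃ y : e ⁻¹' {e z}, Iio y.1.1 := fun i hi =>
      mem_iUnion.2 ⟨⟨q i, hi⟩, hq i⟩
    refine (mk_le_mk_of_subset hsub).trans_lt ?_
    refine (card_iUnion_lt_iff_forall_of_isRegular hreg ?_).2 ?_
    · exact (mk_set_le _).trans_lt (((le_max_right _ _).trans ((le_max_right _ _).trans
        (le_max_right _ _))).trans_lt (he z))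
    · rintro ⟨y, hy⟩
      have hy' := he y
      rw [show e y = e z from hy] at hy'
      exact ((le_max_left _ _).trans (le_max_right _ _)).trans_lt hy'
  have hTcard : ∀ n, ℵ₀ < Order.cof (Iio (g n)) → #(T n) < Order.cof (Iio (g n)) := by
    intro n hn
    by_cases hne : ∃ z, e z = n
    · obtain ⟨z, rfl⟩ := hne
      refine (card_iUnion_lt_iff_forall_of_isRegular (isRegular_orderCof hn.le) (hpcard z)).2
        fun i => mk_image_le.trans_lt ((hS i.1).trans ?_)
      exact ((le_max_left _ _).trans ((le_max_right _ _).trans (le_max_right _ _))).trans_lt (he z)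
    · have : T n = ∅ := by
        refine eq_empty_of_forall_notMem fun x hx => ?_
        obtain ⟨⟨i, hi⟩, -⟩ := mem_iUnion.1 hx
        exact hne ⟨q i, hi⟩
      rw [this, mk_eq_zero]
      exact bot_le.trans_lt hn
  have hh : ∀ n, ∃ y, ℵ₀ < Order.cof (Iio (g n)) → y < g n ∧ ∀ x ∈ T n, x < g n → x < y := by
    intro n
    by_cases hn : ℵ₀ < Order.cof (Iio (g n))
    · obtain ⟨y, hy⟩ := exists_forall_lt_of_mk_lt_cof (s := (Subtype.val ⁻¹' T n : Set (Iio (g n))))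
        ((mk_preimage_of_injective _ _ Subtype.val_injective).trans_lt (hTcard n hn))
      exact ⟨y.1, fun _ => ⟨y.2, fun x hx hxg => hy ⟨x, hxg⟩ hx⟩⟩
    · exact ⟨⊤, fun h => absurd h hn⟩
  choose h hh using hh
  obtain ⟨α, hα⟩ := hexact h ((hcof _ hκ0).mono fun n hn => (hh n hn).1)
  refine ⟨_, ⟨α, rfl⟩, ?_⟩
  obtain ⟨a, ha⟩ := eventually_atTop.1 (hα.and ((hfg α).and (hcof _ hκ0)))
  refine (mk_le_mk_of_subset fun i hi => ?_ : _ ≤ #(Iio a.1)).trans_lt (mk_Iio_ord_lt _)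
  by_contra hia
  obtain ⟨h1, h2, h3⟩ := ha (p i) (show a.1 ≤ (p i).1 from (not_lt.1 hia).trans (hp i).le)
  have hi' : f α (p i) ∈ S i := not_not.1 hi
  exact h1.not_gt ((hh (p i) h3).2 _ (mem_iUnion.2 ⟨⟨i, rfl⟩, ⟨_, hi', rfl⟩⟩) h2)

/-- No family of at most `κ` functions is eventually different: diagonalise along `κ × κ ≃ κ`. -/
theorem succ_le_mk_of_isEventuallyDifferent {κ : Cardinal.{u}} (hκ : ℵ₀ ≤ κ)
    {F : Set (CardInv.Idx κ → CardInv.Idx κ)} (hF : CardInv.IsEventuallyDifferent κ F) :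
    succ κ ≤ #F := by
  classical
  by_contra! hlt
  have hle : #F ≤ #(CardInv.Idx κ) := by
    rw [mk_ord_toType]
    exact lt_succ_iff.1 hlt
  obtain ⟨j⟩ := (Cardinal.le_def _ _).1 hle
  obtain ⟨φ⟩ : Nonempty (CardInv.Idx κ × CardInv.Idx κ ≃ CardInv.Idx κ) := by
    rw [← Cardinal.eq, ← mul_def, mk_ord_toType, mul_eq_self hκ]
  obtain ⟨f, hf, hmost⟩ := hF fun i =>
    if h : ∃ f : F, j f = (φ.symm i).1 then h.choose.1 i else i
  refine hmost.not_ge ?_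
  -- The row of `κ × κ` coded by `f` provides `κ` many coincidences with the diagonal function.
  have hinj : Function.Injective fun b : CardInv.Idx κ => φ (j ⟨f, hf⟩, b) :=
    φ.injective.comp (Prod.mk_right_injective _)
  refine ((mk_ord_toType κ).symm.trans (mk_range_eq _ hinj).symm).trans_le
    (mk_le_mk_of_subset ?_)
  rintro _ ⟨b, rfl⟩
  have hex : ∃ f' : F, j f' = (φ.symm (φ (j ⟨f, hf⟩, b))).1 := ⟨⟨f, hf⟩, by simp⟩
  have heq : hex.choose = ⟨f, hf⟩ := j.injective (by
    rw [hex.choose_spec]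
    simp)
  simp only [mem_ofPred_eq, not_not, dif_pos hex, heq]

theorem CardInv.IsEventuallyAvoiding.isEventuallyDifferent {κ θ : Cardinal.{u}} (h2 : 2 ≤ θ)
    {F : Set (CardInv.Idx κ → CardInv.Idx κ)} (hF : CardInv.IsEventuallyAvoiding κ θ F) :
    CardInv.IsEventuallyDifferent κ F := by
  intro g
  exact hF (fun i => {g i}) fun i => by
    rw [mk_singleton]
    exact Cardinal.one_lt_two.trans_le h2

end Invariants

theorem mainTheorem7 (κ θ : Cardinal.{u}) (hκ : κ.IsSingular) (h2 : 2 ≤ θ) (hθ : θ < κ) :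
    CardInv.eNum κ = CardInv.bNum κ θ ∧ CardInv.bNum κ θ = Order.succ κ := by
  obtain ⟨F, hF, hFc⟩ := exists_isEventuallyAvoiding hκ hθ
  have hb : CardInv.bNum κ θ = Order.succ κ := by
    unfold CardInv.bNum
    refine le_antisymm (le_trans (csInf_le (OrderBot.bddBelow _) ⟨F, hF, rfl⟩) hFc) (le_csInf ⟨_, F, hF, rfl⟩ ?_)
    rintro _ ⟨G, hG, rfl⟩
    exact succ_le_mk_of_isEventuallyDifferent hκ.aleph0_le (hG.isEventuallyDifferent h2)
  refine ⟨hb.symm ▸ ?_, hb⟩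
  unfold CardInv.eNum
  refine le_antisymm (le_trans (csInf_le (OrderBot.bddBelow _)
    ⟨F, hF.isEventuallyDifferent h2, rfl⟩) hFc)
    (le_csInf ⟨_, F, hF.isEventuallyDifferent h2, rfl⟩ ?_)
  rintro _ ⟨G, hG, rfl⟩
  exact succ_le_mk_of_isEventuallyDifferent hκ.aleph0_le hG
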